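/- A halfspace on $\mathbb{R}$ is a function $f(z)=\mathrm{sign}(wz+t)$ with $w\in\{\pm1\}$ and $t\in\mathbb{R}$, where $\mathrm{sign}(x)=1$ for $x\ge 0$ and $\mathrm{sign}(x)=-1$ for $x<0$. A distribution $\mathcal{D}$ on pairs $(z,y)\in\mathbb{R}\times\{\pm1\}$ satisfies the Massart noise condition with parameter $\eta$ with respect to $f$ if there is a measurable function $\eta(\cdot):\mathbb{R}\to[0,\eta]$ such that, conditionally on $z$, one has $y=-f(z)$ with probability $\eta(z)$ and $y=f(z)$ with probability $1-\eta(z)$. Write $\mathcal{D}_z$ and $\mathcal{D}_y$ for the marginals of $\mathcal{D}$. There is an absolute constant $C>0$ such that the following holds. For every $\eta\in(0,1/2)$ there is $\gamma_0=\gamma_0(\eta)>0$ such that for every $\gamma\in(0,\gamma_0)$ there exists a distribution $\mathcal{D}$ on $(z,y)\in\mathbb{R}\times\{\pm1\}$ whose $z$-marginal is the standard normal distribution, with the following properties. 1. $\mathcal{D}$ satisfies the Massart noise condition with parameter $\eta$ with respect to a halfspace $f$ on $\mathbb{R}$ with $\Pr_{z\sim\mathcal{D}_z}[f(z)=1]=\gamma$.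 2. For every integer $k\ge 0$ with $k\le C\log(\eta/\gamma)$, $$\mathbb{E}_{(z,y)\sim\mathcal{D}}[y z^k]=\mathbb{E}_{y\sim\mathcal{D}_y}[y]\;\mathbb{E}_{z\sim\mathcal{D}_z}[z^k].$$ -/

import Mathlib

namespace Massart

/-- The sign function with values in the label set `{±1}`, realised as the units of `ℤ`;
the convention at `0` is `sign 0 = +1`. -/
noncomputable def signLabel (x : ℝ) : ℤˣ := if 0 ≤ x then 1 else -1

/-- A label `y ∈ {±1}` regarded as a real number. -/
def labelVal (y : ℤˣ) : ℝ := ((y : ℤ) : ℝ)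

/-- Halfspaces (linear threshold functions) on the real line: the functions
`z ↦ sign (w * z + t)` with unit normal `w` (that is, `w = 1` or `w = -1`) and `t` real. -/
def IsHalfspace (f : ℝ → ℤˣ) : Prop :=
  ∃ w t : ℝ, |w| = 1 ∧ ∀ z, f z = signLabel (w * z + t)

/-- The Massart noise condition with parameter `η` with respect to `f`, for a distribution `D` of
labeled examples `(x, y)`: there is a noise function `noise` with values in `[0, η]` such that,
conditionally on `x`, the label is `y = - f x` with probability `noise x` and `y = f x` with
probability `1 - noise x`. The two conditional probabilities are spelled out by integrating them
over an arbitrary measurable set `A` against the `x`-marginal `D.fst`. -/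
def SatisfiesMassart {X : Type*} [MeasurableSpace X] (D : MeasureTheory.Measure (X × ℤˣ))
    (η : ℝ) (f : X → ℤˣ) : Prop :=
  ∃ noise : X → ℝ, Measurable noise ∧ (∀ x, 0 ≤ noise x ∧ noise x ≤ η) ∧
    ∀ A : Set X, MeasurableSet A →
      D {p | p.1 ∈ A ∧ p.2 = - f p.1} = ∫⁻ x in A, ENNReal.ofReal (noise x) ∂D.fst ∧
      D {p | p.1 ∈ A ∧ p.2 = f p.1} = ∫⁻ x in A, ENNReal.ofReal (1 - noise x) ∂D.fst

end Massart

/-! Let `f` be `1` exactly on the left tail `T = Iic t` of Gaussian mass `γ`, and let label `1` have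
conditional probability `u = η/2 + (1 - η/2) 1_T + w`, with `w` supported on the positive half-line.
If the Gaussian moments of `w` below degree `N` cancel those of `(1 - η/2) 1_T`, then `2u - 1` acts
on these degrees as the constant `η - 1`, which is the claimed decorrelation. The Massart condition
only needs `|w| ≤ η/2`.

So `w` must be small. Cauchy–Schwarz bounds the tail moments by about `√γ R ^ j`, where `R = √(4N)`
(`abs_setIntegral_pow_gaussianReal_le`). Solving the moment problem on `[0, R]` costs a factor
exponential in `N`, the entry size of the inverse Hilbert matrix (`exists_inverse_hilbert_matrix`,
`exists_continuous_moments`). Dividing by the Gaussian density on `(0, R]` costs another. Hence `|w|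
≤ 6 √γ 9216 ^ N`, which is at most `η/2` when `N` is a small multiple of `log (η / γ)`. -/

/-! ### Inverse Hilbert matrix and the moment problem on an interval. -/

open Finset Nat in
theorem prod_range_erase_abs_sub (a m : ℕ) :
    ∏ k ∈ (range (a + 1 + m)).erase a, |(a : ℝ) - k| = (a ! * m ! : ℕ) := by
  induction m with
  | zero =>
    have h : (range (a + 1 + 0)).erase a = range a := by
      ext; simp only [mem_erase, mem_range]; lia
    rw [h, ← Nat.descFactorial_self a, Nat.descFactorial_eq_prod_range]
    simp only [factorial_zero, mul_one, Nat.cast_prod]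
    refine prod_congr rfl fun k hk => ?_
    have hk : k ≤ a := (mem_range.mp hk).le
    rw [Nat.cast_sub hk, abs_of_nonneg (sub_nonneg.mpr (by exact_mod_cast hk))]
  | succ m ih =>
    rw [← add_assoc, range_add_one, erase_insert_of_ne (by lia), prod_insert (by simp), ih]
    have h : |(a : ℝ) - ((a + 1 + m : ℕ) : ℝ)| = (m + 1 : ℕ) := by
      push_cast
      rw [abs_sub_comm, abs_of_nonneg (by linarith [(Nat.cast_nonneg m : (0 : ℝ) ≤ m)])]
      ring
    rw [h, ← Nat.cast_mul, Nat.factorial_succ m]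
    congr 1
    ring

-- The ratio of the two products is exactly `N * choose (N - 1) a * choose (a + N) N`, and the
-- binomials are at most `2 ^ N` and `4 ^ N`.
open Finset Nat in
theorem prod_range_add_le_mul_prod_erase (N a : ℕ) (ha : a < N) :
    ∏ k ∈ range N, ((a : ℝ) + k + 1) ≤
      8 ^ N * N * ∏ k ∈ (range N).erase a, |(a : ℝ) - k| := by
  obtain ⟨m, rfl⟩ : ∃ m, N = a + 1 + m := ⟨N - (a + 1), by lia⟩
  rw [prod_range_erase_abs_sub]
  have h1 : ∏ k ∈ range (a + 1 + m), ((a : ℝ) + k + 1) =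
      ((a + 1).ascFactorial (a + 1 + m) : ℕ) := by
    rw [Nat.ascFactorial_eq_prod_range, Nat.cast_prod]
    exact prod_congr rfl fun k _ => by push_cast; ring
  rw [h1]
  suffices (a + 1).ascFactorial (a + 1 + m) ≤ 8 ^ (a + 1 + m) * (a + 1 + m) * (a ! * m !) by
    exact_mod_cast this
  have h2 := Nat.choose_mul_factorial_mul_factorial (show a ≤ a + m by lia)
  rw [Nat.add_sub_cancel_left] at h2
  rw [Nat.ascFactorial_eq_factorial_mul_choose]
  calc (a + 1 + m)! * (a + (a + 1 + m)).choose (a + 1 + m)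
      ≤ (a + 1 + m)! * 2 ^ (a + (a + 1 + m)) :=
        Nat.mul_le_mul_left _ (Nat.choose_le_two_pow _ _)
    _ ≤ (a + 1 + m)! * 2 ^ ((a + 1 + m) + (a + 1 + m)) :=
        Nat.mul_le_mul_left _ (Nat.pow_le_pow_right (by norm_num) (by lia))
    _ = (a + 1 + m) * ((a + m).choose a * a ! * m !) * 4 ^ (a + 1 + m) := by
        rw [h2, show a + 1 + m = a + m + 1 by ring, Nat.factorial_succ, ← two_mul, pow_mul]
        norm_num
    _ ≤ (a + 1 + m) * (2 ^ (a + 1 + m) * a ! * m !) * 4 ^ (a + 1 + m) := by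
        gcongr
        exact (Nat.choose_le_two_pow _ _).trans
          (Nat.pow_le_pow_right (by norm_num) (by lia))
    _ = 8 ^ (a + 1 + m) * (a + 1 + m) * (a ! * m !) := by
        rw [show (8 : ℕ) = 2 * 4 by norm_num, mul_pow]
        ring

open Finset in
/-- The coefficients of the polynomials biorthogonal to the monomials on `[0, 1]`, that is the
entries of the inverse Hilbert matrix, grow at most exponentially in the dimension. -/
theorem exists_inverse_hilbert_matrix (N : ℕ) : ∃ c : ℕ → ℕ → ℝ,
    (∀ j < N, ∀ k < N,
      ∑ i ∈ range N, c j i / (k + i + 1 : ℝ) = if k = j then 1 else 0) ∧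
    ∀ j < N, ∀ i < N, |c j i| ≤ 64 ^ N * N ^ 2 := by
  set s := range N with hs
  let v : ℕ → ℝ := fun i => -(i + 1 : ℝ)
  let P : ℕ → Polynomial ℝ := fun j => Lagrange.nodal (s.erase j) (fun k => (k : ℝ))
  let Q : ℝ → ℝ := fun x => (Lagrange.nodal s v).eval x
  have hQ' (k : ℕ) : Q k = ∏ i ∈ s, ((k : ℝ) + i + 1) := by
    simp only [Q, Lagrange.eval_nodal, v]
    exact prod_congr rfl fun i _ => by ring
  have hQ (k : ℕ) : 0 < Q k := by
    rw [hQ']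
    exact prod_pos fun i _ => by positivity
  have hPj (j : ℕ) : |(P j).eval (j : ℝ)| = ∏ k ∈ s.erase j, |(j : ℝ) - k| := by
    simp only [P, Lagrange.eval_nodal, abs_prod]
  have hPpos (j : ℕ) : 0 < |(P j).eval (j : ℝ)| := by
    rw [hPj]
    refine prod_pos fun k hk => abs_pos.mpr (sub_ne_zero.mpr ?_)
    exact_mod_cast (ne_of_mem_erase hk).symm
  have hw (i : ℕ) : |Lagrange.nodalWeight s v i| = |(P i).eval (i : ℝ)|⁻¹ := by
    rw [hPj, Lagrange.nodalWeight, abs_prod, ← prod_inv_distrib]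
    refine prod_congr rfl fun k _ => ?_
    rw [abs_inv, ← abs_neg]
    congr 2
    simp only [v]
    ring
  have hPv (i j : ℕ) : |(P j).eval (v i)| ≤ Q i := by
    simp only [P, Lagrange.eval_nodal, abs_prod]
    have h (k : ℕ) : |v i - k| = (i : ℝ) + k + 1 := by
      simp only [v]
      rw [← abs_neg, abs_of_nonneg (by linarith [(Nat.cast_nonneg k : (0 : ℝ) ≤ k),
        (Nat.cast_nonneg i : (0 : ℝ) ≤ i)])]
      ring
    simp_rw [h, hQ']
    refine prod_le_prod_of_subset_of_one_le (erase_subset _ _) (fun k _ => by positivity)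
      fun k _ _ => ?_
    linarith [(Nat.cast_nonneg k : (0 : ℝ) ≤ k), (Nat.cast_nonneg i : (0 : ℝ) ≤ i)]
  have hQP (j : ℕ) (hj : j < N) : Q j ≤ 8 ^ N * N * |(P j).eval (j : ℝ)| := by
    rw [hQ', hPj]
    exact prod_range_add_le_mul_prod_erase N j hj
  -- Partial fractions: `P j / Q` has simple poles at the nodes `v i = -(i + 1)`, so at `x = k` it
  -- is a combination of the Hilbert entries `1 / (k + i + 1)`. It vanishes at every `k ≠ j` below
  -- `N`; the last factor normalises its value at `j` to `1`.
  refine ⟨fun j i => Lagrange.nodalWeight s v i * (P j).eval (v i) * (Q j / (P j).eval (j : ℝ)),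
    fun j hj k hk => ?_, fun j hj i hi => ?_⟩
  · have hv : Set.InjOn v s := fun a _ b _ hab => by
      simp only [v] at hab
      exact_mod_cast (by linarith : (a : ℝ) = b)
    have hdeg : (P j).degree < s.card := by
      simp only [P, Lagrange.degree_nodal]
      exact_mod_cast card_erase_lt_of_mem (mem_range.mpr hj)
    have hx : ∀ i ∈ s, (k : ℝ) ≠ v i := fun i _ => by
      simp only [v]
      have : (0 : ℝ) < k + (i + 1) := by positivity
      linarith
    have key := Lagrange.eval_interpolate_not_at_node (fun i => (P j).eval (v i)) hx
    rw [← Lagrange.eq_interpolate hv hdeg] at key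
    have hsum : ∑ i ∈ s, Lagrange.nodalWeight s v i * (P j).eval (v i) *
        (Q j / (P j).eval (j : ℝ)) / (k + i + 1 : ℝ) =
        (Q j / (P j).eval (j : ℝ)) * ((P j).eval (k : ℝ) / Q k) := by
      rw [key, mul_div_cancel_left₀ _ (hQ k).ne', mul_sum]
      refine sum_congr rfl fun i _ => ?_
      simp only [v, sub_neg_eq_add, ← add_assoc]
      ring
    rw [hsum]
    split_ifs with h
    · subst h
      have := abs_pos.mp (hPpos k)
      have := (hQ k).ne'
      field_simp
    · have : (P j).eval (k : ℝ) = 0 :=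
        Lagrange.eval_nodal_at_node (mem_erase.mpr ⟨h, mem_range.mpr hk⟩)
      simp [this]
  · rw [abs_mul, abs_mul, hw, abs_div, abs_of_pos (hQ j)]
    have h1 : |(P i).eval (i : ℝ)|⁻¹ * |(P j).eval (v i)| ≤ 8 ^ N * N := by
      rw [inv_mul_le_iff₀ (hPpos i), mul_comm]
      exact (hPv i j).trans (hQP i hi)
    have h2 : Q j / |(P j).eval (j : ℝ)| ≤ 8 ^ N * N := by
      rw [div_le_iff₀ (hPpos j)]
      exact hQP j hj
    calc _ ≤ (8 ^ N * N : ℝ) * (8 ^ N * N) :=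
          mul_le_mul h1 h2 (div_nonneg (hQ j).le (abs_nonneg _)) (by positivity)
      _ = 64 ^ N * N ^ 2 := by
          rw [show (64 : ℝ) = 8 * 8 by norm_num, mul_pow]
          ring

open Finset in
/-- On `[0, R]` every sequence of moments `m k`, `k < N`, is attained by a continuous function
whose size is controlled by that of the rescaled moments. -/
theorem exists_continuous_moments (N : ℕ) {R ε : ℝ} (hR : 0 < R) (m : ℕ → ℝ)
    (hm : ∀ j < N, |m j| ≤ ε * R ^ j) : ∃ q : ℝ → ℝ, Continuous q ∧
      (∀ x ∈ Set.Icc 0 R, |q x| ≤ ε * (64 ^ N * N ^ 4) / R) ∧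
      ∀ k < N, ∫ x in 0..R, q x * x ^ k = m k := by
  obtain ⟨c, hc, hb⟩ := exists_inverse_hilbert_matrix N
  -- The inner sums are the dual polynomials on `[0, 1]`, rescaled; `R ^ (j + 1)` comes from
  -- substituting `x = R s`. The two sums of length `N` raise the entry bound's `N ^ 2` to `N ^ 4`.
  refine ⟨fun x => ∑ j ∈ range N, m j / R ^ (j + 1) * ∑ i ∈ range N, c j i * (x / R) ^ i,
    by fun_prop, fun x hx => ?_, fun k hk => ?_⟩
  · have hx1 : |x / R| ≤ 1 := by
      rw [abs_of_nonneg (div_nonneg hx.1 hR.le)]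
      exact div_le_one_of_le₀ hx.2 hR.le
    have hψ : ∀ j ∈ range N, |∑ i ∈ range N, c j i * (x / R) ^ i| ≤ N * (64 ^ N * N ^ 2) := by
      intro j hj
      refine (abs_sum_le_sum_abs _ _).trans ((sum_le_card_nsmul _ _ ((64 : ℝ) ^ N * (N : ℝ) ^ 2) ?_).trans ?_)
      · intro i hi
        rw [abs_mul, abs_pow]
        exact (mul_le_of_le_one_right (abs_nonneg _) (pow_le_one₀ (abs_nonneg _) hx1)).trans
          (hb j (mem_range.mp hj) i (mem_range.mp hi))
      · simp
    refine (abs_sum_le_sum_abs _ _).trans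
      ((sum_le_card_nsmul _ _ (ε / R * (N * (64 ^ N * N ^ 2))) ?_).trans ?_)
    · intro j hj
      rw [abs_mul]
      have h1 : |m j / R ^ (j + 1)| ≤ ε / R := by
        rw [abs_div, abs_of_pos (pow_pos hR _), div_le_div_iff₀ (pow_pos hR _) hR, pow_succ,
          ← mul_assoc]
        exact mul_le_mul_of_nonneg_right (hm j (mem_range.mp hj)) hR.le
      exact mul_le_mul h1 (hψ j hj) (abs_nonneg _) ((abs_nonneg _).trans h1)
    · rw [card_range, nsmul_eq_mul]
      exact le_of_eq (by ring)
  · have hint (i : ℕ) : ∫ x in 0..R, (x / R) ^ i * x ^ k = R ^ (k + 1) / (k + i + 1) := by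
      have : ∀ x, (x / R) ^ i * x ^ k = (R ^ i)⁻¹ * x ^ (k + i) := fun x => by
        rw [div_pow, pow_add]; ring
      simp_rw [this]
      rw [intervalIntegral.integral_const_mul, integral_pow]
      have := hR.ne'
      push_cast
      field_simp
      simp [pow_add]
      ring
    have hexp : ∀ x, (∑ j ∈ range N, m j / R ^ (j + 1) * ∑ i ∈ range N, c j i * (x / R) ^ i)
        * x ^ k = ∑ j ∈ range N, ∑ i ∈ range N,
          (m j / R ^ (j + 1) * c j i) * ((x / R) ^ i * x ^ k) := fun x => by
      rw [sum_mul]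
      refine sum_congr rfl fun j _ => ?_
      rw [mul_sum, sum_mul]
      exact sum_congr rfl fun i _ => by ring
    simp_rw [hexp]
    rw [intervalIntegral.integral_finsetSum
      fun j _ => Continuous.intervalIntegrable (by fun_prop) _ _]
    have hj : ∀ j ∈ range N, ∫ x in 0..R, ∑ i ∈ range N,
        (m j / R ^ (j + 1) * c j i) * ((x / R) ^ i * x ^ k) =
        m j / R ^ (j + 1) * R ^ (k + 1) * if k = j then 1 else 0 := by
      intro j hj
      rw [intervalIntegral.integral_finsetSum
        fun j _ => Continuous.intervalIntegrable (by fun_prop) _ _, ← hc j (mem_range.mp hj) k hk,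
        mul_sum]
      refine sum_congr rfl fun i _ => ?_
      rw [intervalIntegral.integral_const_mul, hint]
      ring
    rw [sum_congr rfl hj]
    simp only [mul_ite, mul_one, mul_zero]
    rw [sum_ite_eq, if_pos (mem_range.mpr hk)]
    exact div_mul_cancel₀ _ (pow_ne_zero _ hR.ne')

/-! ### Gaussian tails, their moments, and the correction `w`. -/

open MeasureTheory ProbabilityTheory Set Filter Topology in
theorem exists_measure_Iic_eq (μ : Measure ℝ) [IsProbabilityMeasure μ] [NullSingletonClass μ]
    {γ : ℝ} (h0 : 0 < γ) (h1 : γ < 1) : ∃ t, μ (Iic t) = ENNReal.ofReal γ := by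
  have hc : Continuous (cdf μ) := by
    refine continuous_iff_continuousAt.mpr fun a => ?_
    rw [(monotone_cdf μ).continuousAt_iff_leftLim_eq_rightLim, StieltjesFunction.rightLim_eq]
    have h := StieltjesFunction.measure_singleton (cdf μ) a
    rw [measure_cdf, measure_singleton] at h
    have h := ENNReal.ofReal_eq_zero.mp h.symm
    exact le_antisymm ((monotone_cdf μ).leftLim_le le_rfl) (by linarith)
  obtain ⟨a, ha⟩ := ((tendsto_cdf_atBot μ).eventually_lt_const h0).exists
  obtain ⟨b, hb⟩ := ((tendsto_cdf_atTop μ).eventually_const_lt h1).exists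
  obtain ⟨t, ht⟩ := mem_range_of_exists_le_of_exists_ge hc ⟨a, ha.le⟩ ⟨b, hb.le⟩
  exact ⟨t, by rw [← ofReal_cdf, ht]⟩

open MeasureTheory ProbabilityTheory in
theorem gaussianPDFReal_std_eq (x : ℝ) :
    gaussianPDFReal 0 1 x = (√(2 * Real.pi))⁻¹ * Real.exp (-(1 / 2) * x ^ 2) := by
  rw [gaussianPDFReal]
  simp only [NNReal.coe_one, mul_one, sub_zero]
  congr 2
  ring

open MeasureTheory ProbabilityTheory in
theorem gaussianPDFReal_std_mul_exp (x : ℝ) :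
    gaussianPDFReal 0 1 x * Real.exp (x ^ 2 / 4) =
      (√(2 * Real.pi))⁻¹ * Real.exp (-(1 / 4) * x ^ 2) := by
  rw [gaussianPDFReal_std_eq, mul_assoc, ← Real.exp_add]
  congr 2
  ring

open MeasureTheory ProbabilityTheory in
theorem integrable_exp_sq_div_four_gaussianReal :
    Integrable (fun x : ℝ => Real.exp (x ^ 2 / 4)) (gaussianReal 0 1) := by
  rw [gaussianReal_of_var_ne_zero _ one_ne_zero,
    integrable_withDensity_iff_integrable_smul' (measurable_gaussianPDF _ _)
      (ae_of_all _ fun _ => gaussianPDF_lt_top)]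
  simp only [toReal_gaussianPDF, smul_eq_mul, gaussianPDFReal_std_mul_exp]
  exact (integrable_exp_neg_mul_sq (by norm_num)).const_mul _

open MeasureTheory ProbabilityTheory in
theorem integral_exp_sq_div_four_gaussianReal :
    ∫ x : ℝ, Real.exp (x ^ 2 / 4) ∂gaussianReal 0 1 = √2 := by
  rw [integral_gaussianReal_eq_integral_smul one_ne_zero]
  simp only [smul_eq_mul, gaussianPDFReal_std_mul_exp]
  rw [integral_const_mul, integral_gaussian, ← Real.sqrt_inv, ← Real.sqrt_mul (by positivity)]
  congr 1
  have := Real.pi_ne_zero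
  field_simp
  norm_num

open MeasureTheory ProbabilityTheory in
theorem integrable_pow_gaussianReal (k : ℕ) :
    Integrable (fun x : ℝ => x ^ k) (gaussianReal 0 1) := by
  have h := (memLp_id_gaussianReal (μ := 0) (v := 1) k).integrable_norm_pow'
  refine h.mono (by fun_prop) (ae_of_all _ fun x => ?_)
  simp

-- One term of the exponential series at `x ^ 2 / 4`, together with `j ! ≤ N ^ j`.
open Nat in
theorem pow_div_le_exp_sq {N j : ℕ} (hj : j < N) (x : ℝ) :
    (x ^ 2) ^ j ≤ (4 * N : ℝ) ^ j * Real.exp (x ^ 2 / 4) := by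
  have h := Real.pow_div_factorial_le_exp (x := x ^ 2 / 4) (by positivity) j
  rw [div_le_iff₀ (by positivity)] at h
  have hf : (j ! : ℝ) ≤ (N : ℝ) ^ j := by
    exact_mod_cast (Nat.factorial_le_pow j).trans (Nat.pow_le_pow_left hj.le j)
  calc (x ^ 2) ^ j = 4 ^ j * (x ^ 2 / 4) ^ j := by rw [← mul_pow]; congr 1; ring
    _ ≤ 4 ^ j * (Real.exp (x ^ 2 / 4) * N ^ j) := by gcongr; exact h.trans (by gcongr)
    _ = (4 * N : ℝ) ^ j * Real.exp (x ^ 2 / 4) := by rw [mul_pow]; ring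

open MeasureTheory ProbabilityTheory in
/-- Moments of the standard Gaussian restricted to an event of probability `γ`. -/
theorem abs_setIntegral_pow_gaussianReal_le {T : Set ℝ} {γ : ℝ} (hγ : 0 < γ)
    (hTγ : gaussianReal 0 1 T = ENNReal.ofReal γ) {N j : ℕ} (hj : j < N) :
    |∫ x in T, x ^ j ∂gaussianReal 0 1| ≤ 2 * √γ * √(4 * N) ^ j := by
  have hN : (0 : ℝ) < N := by exact_mod_cast (by lia : 0 < N)
  set R : ℝ := √(4 * N) with hR
  have hR0 : 0 < R := Real.sqrt_pos.mpr (by positivity)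
  have hR2 : R ^ 2 = 4 * N := Real.sq_sqrt (by positivity)
  have hs : 0 < √γ := Real.sqrt_pos.mpr hγ
  have hsq : √γ ^ 2 = γ := Real.sq_sqrt hγ.le
  have hint := integrable_exp_sq_div_four_gaussianReal
  -- Pointwise form of Cauchy–Schwarz: AM-GM with weight `√γ`, so that after integration over `T`
  -- both terms are of order `√γ`.
  have hpt (x : ℝ) :
      ‖x ^ j‖ ≤ R ^ j * (1 / (2 * √γ) + √γ / 2 * Real.exp (x ^ 2 / 4)) := by
    set E := Real.exp (x ^ 2 / 4)
    have h1 : |x ^ j| ^ 2 ≤ (R ^ j) ^ 2 * E := by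
      have := pow_div_le_exp_sq hj x
      rw [← hR2] at this
      rw [sq_abs, ← pow_mul, mul_comm j 2, pow_mul, ← pow_mul R j, mul_comm j 2, pow_mul R]
      exact this
    have hRj : 0 < R ^ j := pow_pos hR0 j
    have h2 : 0 ≤ (R ^ j - √γ * |x ^ j|) ^ 2 := sq_nonneg _
    rw [Real.norm_eq_abs]
    have h3 : R ^ j * |x ^ j| * (2 * √γ) ≤ (R ^ j) ^ 2 * (1 + γ * E) := by
      nlinarith [mul_le_mul_of_nonneg_left h1 hγ.le]
    have h4 : |x ^ j| * (2 * √γ) ≤ R ^ j * (1 + γ * E) :=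
      le_of_mul_le_mul_left (by linarith) hRj
    rw [← le_div_iff₀ (by positivity)] at h4
    refine h4.trans (le_of_eq ?_)
    nth_rewrite 1 [← hsq]
    field_simp
  have hreal : (gaussianReal 0 1).real T = γ := by
    rw [Measure.real, hTγ, ENNReal.toReal_ofReal hγ.le]
  have hbi : Integrable (fun x : ℝ => R ^ j * (1 / (2 * √γ) + √γ / 2 * Real.exp (x ^ 2 / 4)))
      (gaussianReal 0 1) := ((integrable_const _).add (hint.const_mul _)).const_mul _
  have hle : ∫ x in T, Real.exp (x ^ 2 / 4) ∂gaussianReal 0 1 ≤ √2 := by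
    rw [← integral_exp_sq_div_four_gaussianReal]
    exact setIntegral_le_integral hint (ae_of_all _ fun x => (Real.exp_pos _).le)
  have h2 : √2 ≤ 2 := Real.sqrt_le_iff.mpr (by norm_num)
  calc |∫ x in T, x ^ j ∂gaussianReal 0 1|
      ≤ ∫ x in T, R ^ j * (1 / (2 * √γ) + √γ / 2 * Real.exp (x ^ 2 / 4)) ∂gaussianReal 0 1 :=
        norm_integral_le_of_norm_le hbi.integrableOn (ae_of_all _ hpt)
    _ = R ^ j * (γ * (1 / (2 * √γ)) +
          √γ / 2 * ∫ x in T, Real.exp (x ^ 2 / 4) ∂gaussianReal 0 1) := by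
        rw [integral_const_mul, integral_add (integrable_const _) (hint.const_mul _).integrableOn,
          integral_const_mul, setIntegral_const, hreal, smul_eq_mul]
    _ = R ^ j * (√γ / 2 + √γ / 2 * ∫ x in T, Real.exp (x ^ 2 / 4) ∂gaussianReal 0 1) := by
        congr 2
        nth_rewrite 1 [← hsq]
        field_simp
    _ ≤ R ^ j * (√γ / 2 + √γ / 2 * 2) := by gcongr; exact hle.trans h2
    _ ≤ 2 * √γ * R ^ j := by nlinarith [mul_pos (pow_pos hR0 j) hs]

open MeasureTheory ProbabilityTheory Set in
/-- A bounded function supported on the positive half-line whose low-degree Gaussian moments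
cancel those of a rare event. -/
theorem exists_bounded_moment_correction {T : Set ℝ} {γ a : ℝ} (hγ : 0 < γ)
    (hTγ : gaussianReal 0 1 T = ENNReal.ofReal γ)
    (ha0 : 0 ≤ a) (ha1 : a ≤ 1) {N : ℕ} (hN : 0 < N) :
    ∃ w : ℝ → ℝ, Measurable w ∧ (∀ x, |w x| ≤ 6 * √γ * 9216 ^ N) ∧ (∀ x ≤ 0, w x = 0) ∧
      ∀ k < N, ∫ x, w x * x ^ k ∂gaussianReal 0 1 = -a * ∫ x in T, x ^ k ∂gaussianReal 0 1 := by
  have hN1 : (1 : ℝ) ≤ N := by exact_mod_cast hN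
  set R : ℝ := √(4 * N) with hR
  have hR1 : 1 ≤ R := Real.one_le_sqrt.mpr (by linarith)
  have hR0 : 0 < R := by linarith
  have hR2 : R ^ 2 = 4 * N := Real.sq_sqrt (by positivity)
  obtain ⟨q, hqc, hqb, hqm⟩ := exists_continuous_moments N (ε := 2 * √γ) hR0
    (fun k => -a * ∫ x in T, x ^ k ∂gaussianReal 0 1) fun j hj => by
      rw [abs_mul, abs_neg, abs_of_nonneg ha0]
      exact (mul_le_of_le_one_left (abs_nonneg _) ha1).trans
        (abs_setIntegral_pow_gaussianReal_le hγ hTγ hj)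
  have hpdf (x : ℝ) : 0 < gaussianPDFReal 0 1 x := gaussianPDFReal_pos _ _ _ one_ne_zero
  -- Dividing by the density turns Gaussian moments into Lebesgue moments of `q`. On `(0, R]` the
  -- density is at least `9⁻ᴺ / 3`, since `R ^ 2 / 2 = 2N` and `e ^ 2 < 9`; with `N ^ 4 ≤ 16 ^ N`
  -- this gives `9216 = 64 * 16 * 9`.
  refine ⟨(Ioc 0 R).indicator fun x => q x / gaussianPDFReal 0 1 x,
    (hqc.measurable.div (measurable_gaussianPDFReal _ _)).indicator measurableSet_Ioc,
    fun x => ?_, fun x hx => indicator_of_notMem (fun h => hx.not_gt h.1) _, fun k hk => ?_⟩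
  · by_cases hx : x ∈ Ioc 0 R
    · rw [indicator_of_mem hx, abs_div, abs_of_pos (hpdf x), div_le_iff₀ (hpdf x)]
      have hq : |q x| ≤ 2 * √γ * (64 ^ N * N ^ 4) :=
        (hqb x ⟨hx.1.le, hx.2⟩).trans (div_le_self (by positivity) hR1)
      have hNpow : (N : ℝ) ^ 4 ≤ 16 ^ N := by
        have : (N : ℝ) ≤ 2 ^ N := by exact_mod_cast Nat.lt_two_pow_self.le
        calc (N : ℝ) ^ 4 ≤ (2 ^ N) ^ 4 := by gcongr
          _ = 16 ^ N := by rw [← pow_mul, mul_comm, pow_mul]; norm_num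
      have hexp : (9 ^ N : ℝ)⁻¹ ≤ Real.exp (-(1 / 2) * x ^ 2) := by
        have h1 : Real.exp (2 * N) ≤ 9 ^ N := by
          rw [mul_comm, Real.exp_nat_mul]
          gcongr
          have := Real.exp_one_lt_d9
          rw [show (2 : ℝ) = 1 + 1 by norm_num, Real.exp_add]
          nlinarith [Real.exp_pos 1]
        refine (inv_anti₀ (Real.exp_pos _) h1).trans ?_
        rw [← Real.exp_neg]
        gcongr
        have : x ^ 2 ≤ R ^ 2 := pow_le_pow_left₀ hx.1.le hx.2 2
        linarith
      have hpi : (3 : ℝ)⁻¹ ≤ (√(2 * Real.pi))⁻¹ := by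
        refine inv_anti₀ (Real.sqrt_pos.mpr (by positivity)) ?_
        refine Real.sqrt_le_iff.mpr ⟨by norm_num, ?_⟩
        linarith [Real.pi_lt_d2]
      calc |q x| ≤ 2 * √γ * (64 ^ N * N ^ 4) := hq
        _ ≤ 2 * √γ * (64 ^ N * 16 ^ N) := by gcongr
        _ = 6 * √γ * 9216 ^ N * (3⁻¹ * (9 ^ N)⁻¹) := by
          rw [show (9216 : ℝ) = 64 * 16 * 9 by norm_num, mul_pow, mul_pow]
          field_simp
          ring
        _ ≤ 6 * √γ * 9216 ^ N * gaussianPDFReal 0 1 x := by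
          rw [gaussianPDFReal_std_eq]
          gcongr
    · rw [indicator_of_notMem hx, abs_zero]
      positivity
  · rw [integral_gaussianReal_eq_integral_smul one_ne_zero, ← hqm k hk,
      intervalIntegral.integral_of_le hR0.le, ← integral_indicator measurableSet_Ioc]
    congr 1
    funext x
    by_cases hx : x ∈ Ioc 0 R
    · simp only [indicator_of_mem hx, smul_eq_mul]
      have := (hpdf x).ne'
      field_simp
    · simp [indicator_of_notMem hx]

/-! ### Labeled distributions with prescribed conditional label probability. -/

instance : DiscreteMeasurableSpace ℤˣ where
  forall_measurableSet s :=
    ⟨Units.val '' s, MeasurableSet.of_discrete, Set.preimage_image_eq _ Units.val_injective⟩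

open MeasureTheory in
/-- The distribution of labeled examples with `x`-marginal `μ` and label `1` of conditional
probability `u`. -/
noncomputable def labeledMeasure {X : Type*} [MeasurableSpace X] (μ : Measure X) (u : X → ℝ) :
    Measure (X × ℤˣ) :=
  (μ.withDensity fun x => ENNReal.ofReal (u x)).map (fun x => (x, 1)) +
    (μ.withDensity fun x => ENNReal.ofReal (1 - u x)).map (fun x => (x, -1))

section labeledMeasure

open MeasureTheory

variable {X : Type*} [MeasurableSpace X] {μ : Measure X} {u : X → ℝ}

theorem lintegral_labeledMeasure (hu : Measurable u) {g : X × ℤˣ → ENNReal} (hg : Measurable g) :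
    ∫⁻ p, g p ∂labeledMeasure μ u =
      ∫⁻ x, ENNReal.ofReal (u x) * g (x, 1) + ENNReal.ofReal (1 - u x) * g (x, -1) ∂μ := by
  have h (y : ℤˣ) : Measurable fun x : X => (x, y) := measurable_prodMk_right
  have hgy (y : ℤˣ) : Measurable fun x => g (x, y) := hg.comp (h y)
  have hu1 : Measurable fun x => ENNReal.ofReal (u x) := by fun_prop
  have hu2 : Measurable fun x => ENNReal.ofReal (1 - u x) := by fun_prop
  rw [labeledMeasure, lintegral_add_measure, lintegral_map hg (h 1), lintegral_map hg (h (-1)),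
    lintegral_withDensity_eq_lintegral_mul _ hu1 (hgy 1),
    lintegral_withDensity_eq_lintegral_mul _ hu2 (hgy (-1)),
    ← lintegral_add_left (hu1.mul (hgy 1))]
  rfl

theorem labeledMeasure_apply (hu : Measurable u) {S : Set (X × ℤˣ)} (hS : MeasurableSet S) :
    labeledMeasure μ u S = ∫⁻ x, ENNReal.ofReal (u x) * S.indicator 1 (x, 1) +
      ENNReal.ofReal (1 - u x) * S.indicator 1 (x, -1) ∂μ := by
  rw [← lintegral_indicator_one hS, lintegral_labeledMeasure hu (measurable_one.indicator hS)]

theorem fst_labeledMeasure (hu : Measurable u) (hu01 : ∀ x, 0 ≤ u x ∧ u x ≤ 1) :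
    (labeledMeasure μ u).fst = μ := by
  ext A hA
  rw [Measure.fst_apply hA, labeledMeasure_apply hu (measurable_fst hA),
    ← lintegral_indicator_one hA]
  refine lintegral_congr fun x => ?_
  have h : ENNReal.ofReal (u x) + ENNReal.ofReal (1 - u x) = 1 := by
    rw [← ENNReal.ofReal_add (hu01 x).1 (by linarith [(hu01 x).2])]
    simp
  by_cases hx : x ∈ A <;> simp [hx, h]

theorem satisfiesMassart_labeledMeasure (hu : Measurable u) (hu01 : ∀ x, 0 ≤ u x ∧ u x ≤ 1)
    {η : ℝ} {f : X → ℤˣ} (hf : Measurable f) (hpos : ∀ x, f x = 1 → 1 - η ≤ u x)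
    (hneg : ∀ x, f x = -1 → u x ≤ η) :
    Massart.SatisfiesMassart (labeledMeasure μ u) η f := by
  have hm : MeasurableSet {x | f x = 1} := hf (MeasurableSet.of_discrete (s := {1}))
  have h1 : (1 : ℤˣ) ≠ -1 := by decide
  classical
  refine ⟨fun x => if f x = 1 then 1 - u x else u x,
    Measurable.ite hm (measurable_const.sub hu) hu, fun x => ?_, fun A hA => ?_⟩
  · rcases Int.units_eq_one_or (f x) with h | h
    · simp only [h, if_true]
      constructor <;> linarith [hpos x h, (hu01 x).2]
    · simp only [h, h1.symm, if_false]
      exact ⟨(hu01 x).1, hneg x h⟩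
  · have hset (g : X → ℤˣ) (hg : Measurable g) :
        MeasurableSet {p : X × ℤˣ | p.1 ∈ A ∧ p.2 = g p.1} :=
      (measurable_fst hA).inter
        (measurableSet_eq_fun measurable_snd (hg.comp measurable_fst))
    rw [fst_labeledMeasure hu hu01]
    constructor
    · rw [labeledMeasure_apply hu
        (hset (fun x => -f x) ((measurable_of_countable (fun y : ℤˣ => -y)).comp hf)),
        ← lintegral_indicator hA]
      refine lintegral_congr fun x => ?_
      by_cases hx : x ∈ A <;> rcases Int.units_eq_one_or (f x) with h | h <;>
        simp [hx, h, h1, h1.symm, Set.indicator]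
    · rw [labeledMeasure_apply hu (hset f hf), ← lintegral_indicator hA]
      refine lintegral_congr fun x => ?_
      by_cases hx : x ∈ A <;> rcases Int.units_eq_one_or (f x) with h | h <;>
        simp [hx, h, h1, h1.symm, Set.indicator]

theorem integral_labeledMeasure (hu : Measurable u) (hu01 : ∀ x, 0 ≤ u x ∧ u x ≤ 1)
    {g : X → ℝ} (hgm : Measurable g) (hg : Integrable g μ) :
    ∫ p, Massart.labelVal p.2 * g p.1 ∂labeledMeasure μ u = ∫ x, (2 * u x - 1) * g x ∂μ := by
  have hlab : Measurable Massart.labelVal := measurable_of_countable _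
  have hF : Measurable fun p : X × ℤˣ => Massart.labelVal p.2 * g p.1 :=
    (hlab.comp measurable_snd).mul (hgm.comp measurable_fst)
  have hpair (y : ℤˣ) : Measurable fun x : X => (x, y) := measurable_prodMk_right
  have hv1 : Massart.labelVal 1 = 1 := by simp [Massart.labelVal]
  have hv2 : Massart.labelVal (-1) = -1 := by simp [Massart.labelVal]
  have hden (v : X → ℝ) (hv : Measurable v) (hv01 : ∀ x, 0 ≤ v x ∧ v x ≤ 1) (y : ℤˣ) :
      Integrable (fun x => v x * (Massart.labelVal y * g x)) μ ∧
      Integrable (fun p : X × ℤˣ => Massart.labelVal p.2 * g p.1)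
        ((μ.withDensity fun x => ENNReal.ofReal (v x)).map (fun x => (x, y))) ∧
      ∫ p, Massart.labelVal p.2 * g p.1
        ∂(μ.withDensity fun x => ENNReal.ofReal (v x)).map (fun x => (x, y)) =
        ∫ x, v x * (Massart.labelVal y * g x) ∂μ := by
    have hi : Integrable (fun x => v x * (Massart.labelVal y * g x)) μ :=
      (hg.const_mul _).bdd_mul (c := 1) hv.aestronglyMeasurable (ae_of_all _ fun x => by
        rw [Real.norm_eq_abs, abs_of_nonneg (hv01 x).1]; exact (hv01 x).2)
    have hlt : ∀ᵐ x ∂μ, ENNReal.ofReal (v x) < ⊤ := ae_of_all _ fun _ => ENNReal.ofReal_lt_top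
    have hvm : Measurable fun x => ENNReal.ofReal (v x) := by fun_prop
    refine ⟨hi, ?_, ?_⟩
    · rw [integrable_map_measure hF.aestronglyMeasurable (hpair y).aemeasurable,
        integrable_withDensity_iff_integrable_smul' hvm hlt]
      simpa only [Function.comp_apply, smul_eq_mul, ENNReal.toReal_ofReal (hv01 _).1] using hi
    · rw [integral_map (hpair y).aemeasurable hF.aestronglyMeasurable,
        integral_withDensity_eq_integral_toReal_smul hvm hlt]
      simp only [smul_eq_mul, ENNReal.toReal_ofReal (hv01 _).1]
  obtain ⟨hi1, hI1, he1⟩ := hden u hu hu01 1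
  obtain ⟨hi2, hI2, he2⟩ := hden (fun x => 1 - u x) (by fun_prop)
    (fun x => ⟨by linarith [(hu01 x).2], by linarith [(hu01 x).1]⟩) (-1)
  rw [labeledMeasure, integral_add_measure hI1 hI2, he1, he2, ← integral_add hi1 hi2]
  refine integral_congr_ae (ae_of_all _ fun x => ?_)
  simp only [hv1, hv2]
  ring

end labeledMeasure

/-! ### Construction of the Massart distribution and choice of parameters. -/

open MeasureTheory ProbabilityTheory Set in
/-- If the Gaussian mass `γ` of a left half-line is small enough compared with the degree `N`,
some Massart distribution for that half-line has uncorrelated label and moments below `N`. -/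
theorem exists_massart_moment_matching {η γ t : ℝ} (hη0 : 0 < η) (hη1 : η < 1 / 2) (hγ : 0 < γ)
    (ht : t < 0) (htγ : gaussianReal 0 1 (Iic t) = ENNReal.ofReal γ) {N : ℕ} (hN : 0 < N)
    (hsmall : 12 * √γ * 9216 ^ N ≤ η) :
    ∃ D : Measure (ℝ × ℤˣ), IsProbabilityMeasure D ∧ D.fst = gaussianReal 0 1 ∧
      (∃ f : ℝ → ℤˣ, Massart.IsHalfspace f ∧ D.fst {z | f z = 1} = ENNReal.ofReal γ ∧
        Massart.SatisfiesMassart D η f) ∧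
      ∀ k < N, ∫ p, Massart.labelVal p.2 * p.1 ^ k ∂D =
        (∫ y, Massart.labelVal y ∂D.snd) * ∫ z, z ^ k ∂D.fst := by
  obtain ⟨w, hwm, hwb, hw0, hwi⟩ := exists_bounded_moment_correction (a := 1 - η / 2) hγ htγ
    (by linarith) (by linarith) hN
  -- The base value `η / 2` is the midpoint of `[0, η]`, leaving room `η / 2` for `w` on both sides.
  -- On the tail `w` vanishes because `t < 0`, so `u = 1` there.
  set u : ℝ → ℝ := fun x => η / 2 + (Iic t).indicator (fun _ => 1 - η / 2) x + w x with hu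
  have hum : Measurable u :=
    (measurable_const.add (measurable_const.indicator measurableSet_Iic)).add hwm
  have hu_le {x : ℝ} (hx : x ≤ t) : u x = 1 := by
    simp only [hu]
    rw [indicator_of_mem (mem_Iic.mpr hx), hw0 x (by linarith)]
    ring
  have hu_gt {x : ℝ} (hx : t < x) : 0 ≤ u x ∧ u x ≤ η := by
    simp only [hu]
    rw [indicator_of_notMem (notMem_Iic.mpr hx)]
    have := abs_le.mp (hwb x)
    constructor <;> linarith
  have hu01 (x : ℝ) : 0 ≤ u x ∧ u x ≤ 1 := by
    rcases le_or_gt x t with hx | hx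
    · rw [hu_le hx]; norm_num
    · exact ⟨(hu_gt hx).1, by linarith [(hu_gt hx).2]⟩
  set f : ℝ → ℤˣ := fun z => Massart.signLabel (-1 * z + t) with hf
  have hfpos (z : ℝ) : f z = 1 ↔ z ≤ t := by
    have h1 : (-1 : ℤˣ) ≠ 1 := by decide
    simp only [hf, Massart.signLabel]
    split_ifs with h
    · exact ⟨fun _ => by linarith, fun _ => rfl⟩
    · exact ⟨fun h' => (h1 h').elim, fun h' => (h (by linarith)).elim⟩
  have hfset : {z | f z = 1} = Iic t := ext hfpos
  have hfm : Measurable f :=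
    Measurable.ite (measurableSet_le measurable_const (by fun_prop)) measurable_const
      measurable_const
  have hfst : (labeledMeasure (gaussianReal 0 1) u).fst = gaussianReal 0 1 :=
    fst_labeledMeasure hum hu01
  have hmom (k : ℕ) (hk : k < N) :
      ∫ p, Massart.labelVal p.2 * p.1 ^ k ∂labeledMeasure (gaussianReal 0 1) u =
        (η - 1) * ∫ z, z ^ k ∂gaussianReal 0 1 := by
    have hint := integrable_pow_gaussianReal k
    rw [integral_labeledMeasure hum hu01 (by fun_prop) hint]
    have hwint : Integrable (fun x => w x * x ^ k) (gaussianReal 0 1) :=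
      hint.bdd_mul hwm.aestronglyMeasurable (ae_of_all _ hwb)
    have hexp (x : ℝ) : (2 * u x - 1) * x ^ k = (η - 1) * x ^ k +
        ((2 - η) * (Iic t).indicator (fun x => x ^ k) x + 2 * (w x * x ^ k)) := by
      simp only [hu]
      by_cases hx : x ∈ Iic t
      · rw [indicator_of_mem hx, indicator_of_mem hx]; ring
      · rw [indicator_of_notMem hx, indicator_of_notMem hx]; ring
    simp_rw [hexp]
    have hi2 := (hint.indicator (measurableSet_Iic (a := t))).const_mul (2 - η)
    have hi3 : Integrable (fun x => (2 - η) * (Iic t).indicator (fun x => x ^ k) x +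
        2 * (w x * x ^ k)) (gaussianReal 0 1) := hi2.add (hwint.const_mul 2)
    rw [integral_add (hint.const_mul _) hi3, integral_add hi2 (hwint.const_mul 2), integral_const_mul, integral_const_mul,
      integral_const_mul, integral_indicator measurableSet_Iic, hwi k hk]
    ring
  refine ⟨labeledMeasure (gaussianReal 0 1) u, ⟨?_⟩, hfst,
    ⟨f, ⟨-1, t, by simp, fun z => rfl⟩, by rw [hfst, hfset, htγ], ?_⟩, fun k hk => ?_⟩
  · rw [← Measure.fst_univ, hfst, measure_univ]
  · refine satisfiesMassart_labeledMeasure hum hu01 hfm (fun x hx => ?_) fun x hx => ?_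
    · rw [hu_le ((hfpos x).mp hx)]; linarith
    · refine (hu_gt (not_le.mp fun h => ?_)).2
      have := (hfpos x).mpr h
      rw [hx] at this
      exact absurd this (by decide)
  · have hsnd : ∫ y, Massart.labelVal y ∂(labeledMeasure (gaussianReal 0 1) u).snd = η - 1 := by
      rw [Measure.snd, integral_map measurable_snd.aemeasurable
        (measurable_of_countable _).aestronglyMeasurable]
      simpa using hmom 0 hN
    rw [hfst, hsnd, hmom k hk]

open MeasureTheory ProbabilityTheory Set in
theorem gaussianReal_Iic_pos (a : ℝ) : 0 < gaussianReal 0 1 (Iic a) := by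
  refine pos_iff_ne_zero.mpr fun h => ?_
  simpa using gaussianReal_absolutelyContinuous' 0 one_ne_zero h

/-- With `C = 1 / (4 log B)`, the power `B ^ (C log (η / γ))` is at most `γ ^ (-1 / 4)`. -/
theorem sqrt_mul_pow_floor_le {B η γ : ℝ} (hB : 1 < B) (hη : 0 < η) (hη1 : η ≤ 1) (hγ : 0 < γ)
    (hγη : γ ≤ (η / B) ^ 4) :
    √γ * B ^ (⌊1 / (4 * Real.log B) * Real.log (η / γ)⌋₊ + 1) ≤ η := by
  have hlogB : 0 < Real.log B := Real.log_pos hB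
  have hB0 : 0 < B := by linarith
  set L := Real.log (η / γ)
  have hγη' : γ ≤ η := by
    have h : η / B ≤ η := div_le_self hη.le hB.le
    calc γ ≤ (η / B) ^ 4 := hγη
      _ ≤ η ^ 4 := by gcongr
      _ ≤ η := pow_le_of_le_one hη.le hη1 (by norm_num)
  have hL : 0 ≤ L := Real.log_nonneg ((one_le_div hγ).mpr hγη')
  set n := ⌊1 / (4 * Real.log B) * L⌋₊
  have hn : (n : ℝ) ≤ 1 / (4 * Real.log B) * L := Nat.floor_le (by positivity)
  have h4 : (B ^ n) ^ 4 ≤ η / γ := by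
    rw [← Real.log_le_log_iff (by positivity) (by positivity), Real.log_pow, Real.log_pow]
    rw [div_mul_eq_mul_div, one_mul, le_div_iff₀ (by positivity)] at hn
    push_cast
    linarith
  have hs4 : √γ ^ 4 = γ ^ 2 := by
    rw [show (4 : ℕ) = 2 * 2 by norm_num, pow_mul, Real.sq_sqrt hγ.le]
  -- In fourth powers, `√γ` gives `γ ^ 2` while `B ^ n` costs at most `η / γ`; the remaining `γ`
  -- absorbs `B ^ 4`.
  refine le_of_pow_le_pow_left₀ (n := 4) (by norm_num) hη.le ?_
  calc (√γ * B ^ (n + 1)) ^ 4 = γ ^ 2 * B ^ 4 * (B ^ n) ^ 4 := by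
        rw [mul_pow, hs4, pow_succ B, mul_pow]; ring
    _ ≤ γ ^ 2 * B ^ 4 * (η / γ) := by gcongr
    _ = γ * B ^ 4 * η := by field_simp
    _ ≤ (η / B) ^ 4 * B ^ 4 * η := by gcongr
    _ = η ^ 4 * η := by field_simp
    _ ≤ η ^ 4 := mul_le_of_le_one_right (by positivity) hη1


theorem proposition6p7 :
    ∃ C : ℝ, 0 < C ∧
      ∀ η : ℝ, 0 < η → η < 1 / 2 →
        ∃ γ₀ : ℝ, 0 < γ₀ ∧
          ∀ γ : ℝ, 0 < γ → γ < γ₀ →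
            ∃ D : MeasureTheory.Measure (ℝ × ℤˣ),
              MeasureTheory.IsProbabilityMeasure D ∧
              D.fst = ProbabilityTheory.gaussianReal 0 1 ∧
              (∃ f : ℝ → ℤˣ, Massart.IsHalfspace f ∧
                D.fst {z | f z = 1} = ENNReal.ofReal γ ∧
                Massart.SatisfiesMassart D η f) ∧
              ∀ k : ℕ, (k : ℝ) ≤ C * Real.log (η / γ) →
                ∫ p, Massart.labelVal p.2 * p.1 ^ k ∂D =
                  (∫ y, Massart.labelVal y ∂D.snd) * ∫ z, z ^ k ∂D.fst := by
  -- The prefactor `12` is absorbed into the base through `12 ≤ 12 ^ (n + 1)`.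
  have hB : (1 : ℝ) < 12 * 9216 := by norm_num
  refine ⟨1 / (4 * Real.log (12 * 9216)), by have := Real.log_pos hB; positivity,
    fun η hη0 hη1 => ?_⟩
  set p := ProbabilityTheory.gaussianReal 0 1 (Set.Iic 0) with hp
  have hp0 : 0 < p.toReal :=
    ENNReal.toReal_pos (gaussianReal_Iic_pos 0).ne' (MeasureTheory.measure_ne_top _ _)
  have hp1 : p.toReal ≤ 1 :=
    ENNReal.toReal_le_of_le_ofReal zero_le_one (by simpa using MeasureTheory.prob_le_one)
  -- The first bound makes the correction small enough; the second, `γ` below the mass of `Iic 0`,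
  -- forces `t < 0`.
  refine ⟨min ((η / (12 * 9216)) ^ 4) p.toReal, by positivity, fun γ hγ hγlt => ?_⟩
  have hγp : γ < p.toReal := hγlt.trans_le (min_le_right _ _)
  have := ProbabilityTheory.nullSingletonClass_gaussianReal (μ := 0) one_ne_zero
  obtain ⟨t, ht⟩ := exists_measure_Iic_eq (ProbabilityTheory.gaussianReal 0 1) hγ
    (hγp.trans_le hp1)
  have ht0 : t < 0 := by
    by_contra! h
    have hle : p ≤ ENNReal.ofReal γ := by
      rw [← ht]
      exact MeasureTheory.measure_mono (Set.Iic_subset_Iic.mpr h)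
    exact hγp.not_ge (ENNReal.toReal_le_of_le_ofReal hγ.le hle)
  have hsmall := sqrt_mul_pow_floor_le hB hη0 (by linarith) hγ (hγlt.le.trans (min_le_left _ _))
  set n := ⌊1 / (4 * Real.log (12 * 9216)) * Real.log (η / γ)⌋₊
  have h12 : (12 : ℝ) ≤ 12 ^ (n + 1) := le_self_pow₀ (by norm_num) (by simp)
  obtain ⟨D, hD, hfst, hf, hmom⟩ := exists_massart_moment_matching hη0 hη1 hγ ht0 ht
    (Nat.succ_pos n) <| calc
      12 * √γ * 9216 ^ (n + 1) ≤ 12 ^ (n + 1) * √γ * 9216 ^ (n + 1) := by gcongr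
      _ = √γ * (12 * 9216) ^ (n + 1) := by rw [mul_pow]; ring
      _ ≤ η := hsmall
  exact ⟨D, hD, hfst, hf, fun k hk => hmom k (Nat.lt_succ_of_le (Nat.le_floor hk))⟩
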